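/- For integers $p,q,r,a,b,c$ let $K\left(\begin{smallmatrix} p & q & r\\ a & b & c\end{smallmatrix}\right)$ be the unoriented link in 3-space with the following diagram. Fix a circle in the plane, divided into six consecutive arcs $A_1,B_1,A_2,B_2,A_3,B_3$. Take a Y-shaped tree on one side of the circle with its three leaves on $A_1,A_2,A_3$, and a Y-shaped tree on the other side with its three leaves on $B_1,B_2,B_3$. Thicken each tree to a Y-shaped band surface (a disk), whose three ends are the arcs $A_i$, respectively $B_i$, and put $p,q,r$ half twists (crossings) in the bands ending on $A_1,A_2,A_3$ and $a,b,c$ half twists in the bands ending on $B_1,B_2,B_3$, so that the six bands occur around the circle in the order $p,a,q,b,r,c$. The link consists of the boundary edges of the bands, which meet at the six division points of the circle. The sign of a label fixes the handedness of its half twists, by the same rule for all six bands: the crossings of a band with positive label are positive crossings when the two edges of the band are given opposite directions along the band. Links are considered equal if they are isotopic (equivalently, if their diagrams are related by planar isotopy and Reidemeister moves); mirror images are not identified. For $n\ge 0$ let $S_n=S_n(A)=\sum_{i=1}^{n}A^{2-i}(-A^3)^{n-i}\in\mathbb Z[A,A^{-1}]$ (so $S_0=0$), and let $S_{-n}(A)=S_n(A^{-1})$.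 **Theorem.** Let $p,q,r,a,b,c$ be even integers. If $K\left(\begin{smallmatrix} p & q & r\\ a & b & c\end{smallmatrix}\right)=K\left(\begin{smallmatrix} p & q & r\\ c & a & b\end{smallmatrix}\right)$, then $$\left|\begin{matrix} S_pA^p & S_qA^q & S_rA^r\\ S_cA^c & S_aA^a & S_bA^b\\ 1&1&1\end{matrix}\right|=0 .$$ If $K\left(\begin{smallmatrix} p & q & r\\ a & b & c\end{smallmatrix}\right)=K\left(\begin{smallmatrix} p & q & r\\ b & c & a\end{smallmatrix}\right)$, then $$\left|\begin{matrix} S_pA^p & S_qA^q & S_rA^r\\ S_aA^a & S_bA^b & S_cA^c\\ 1&1&1\end{matrix}\right|=0 .$$ -/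

import Mathlib

/-!
# Link diagrams, links, and the diagrams `K(p, q, r; a, b, c)`

Unoriented link diagrams in the plane, in general position with respect to the height function,
are cut by horizontal lines into elementary slices, each containing a single local minimum,
a single local maximum or a single crossing, next to vertical strands. A diagram is thus a word in
such slices, read from the bottom to the top. Links are link diagrams up to planar isotopy and the
three Reidemeister moves, which for diagrams in general position amount to the local moves
`LinkDiagram.LocalMove`. Mirror images are not identified.
-/

/-- The elementary pieces of a link diagram in general position with respect to the height:
a local minimum `cup`, a local maximum `cap`, and a crossing of two strands. In `crossing true` the
strand running from the bottom left to the top right is the over-strand, in `crossing false` it is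
the under-strand. -/
inductive Piece where
  | cup : Piece
  | cap : Piece
  | crossing (rising : Bool) : Piece

namespace Piece

/-- The number of strands entering a piece from below. -/
def ins : Piece → ℕ
  | cup => 0
  | cap => 2
  | crossing _ => 2

/-- The number of strands leaving a piece at the top. -/
def outs : Piece → ℕ
  | cup => 2
  | cap => 0
  | crossing _ => 2

end Piece

/-- A horizontal slice of a diagram: one elementary piece with exactly `pos` vertical strands to
the left of it (and any number of vertical strands to the right of it). -/
structure Slice where
  piece : Piece
  pos : ℕ

/-- `IsTangle w m n`: the slices in `w` can be stacked, from the bottom to the top, to a tangle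
diagram with `m` endpoints at the bottom and `n` endpoints at the top. -/
def IsTangle : List Slice → ℕ → ℕ → Prop
  | [], m, n => m = n
  | s :: w, m, n => s.pos + s.piece.ins ≤ m ∧ IsTangle w (m - s.piece.ins + s.piece.outs) n

theorem IsTangle.append {u v : List Slice} {l m n : ℕ} (hu : IsTangle u l m)
    (hv : IsTangle v m n) : IsTangle (u ++ v) l n := by
  induction u generalizing l with
  | nil => cases hu; exact hv
  | cons s u ih => exact ⟨hu.1, ih hu.2⟩

/-- A link diagram: a stack of slices without endpoints. -/
structure LinkDiagram where
  word : List Slice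
  closed : IsTangle word 0 0

namespace LinkDiagram

/-- The local moves. The first four are planar isotopies, the last three are the Reidemeister
moves. -/
inductive LocalMove : List Slice → List Slice → Prop
  /-- Two pieces with disjoint sets of strands exchange their heights; `k` strands run between
  them. -/
  | exchange (x y : Piece) (i k : ℕ) :
      LocalMove [⟨x, i⟩, ⟨y, i + x.outs + k⟩] [⟨y, i + x.ins + k⟩, ⟨x, i⟩]
  /-- A strand with a local minimum followed by a local maximum to its right is straightened. -/
  | zigzag_right (i : ℕ) : LocalMove [⟨.cup, i⟩, ⟨.cap, i + 1⟩] []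
  /-- A strand with a local minimum followed by a local maximum to its left is straightened. -/
  | zigzag_left (i : ℕ) : LocalMove [⟨.cup, i + 1⟩, ⟨.cap, i⟩] []
  /-- A strand crossing the left leg of a local maximum is moved to its right leg. The strand stays
  on the same side (over or under) of the maximum. -/
  | slide_cap (i : ℕ) (e : Bool) :
      LocalMove [⟨.crossing e, i⟩, ⟨.cap, i + 1⟩] [⟨.crossing (!e), i + 1⟩, ⟨.cap, i⟩]
  /-- A strand crossing the left leg of a local minimum is moved to its right leg. The strand stays
  on the same side (over or under) of the minimum. -/
  | slide_cup (i : ℕ) (e : Bool) :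
      LocalMove [⟨.cup, i + 1⟩, ⟨.crossing e, i⟩] [⟨.cup, i⟩, ⟨.crossing (!e), i + 1⟩]
  /-- First Reidemeister move: a curl at a local maximum is removed. -/
  | reidemeister_one_cap (i : ℕ) (e : Bool) :
      LocalMove [⟨.crossing e, i⟩, ⟨.cap, i⟩] [⟨.cap, i⟩]
  /-- First Reidemeister move: a curl at a local minimum is removed. -/
  | reidemeister_one_cup (i : ℕ) (e : Bool) :
      LocalMove [⟨.cup, i⟩, ⟨.crossing e, i⟩] [⟨.cup, i⟩]
  /-- Second Reidemeister move: two strands, one of them lying over the other one, are separated. -/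
  | reidemeister_two (i : ℕ) (e : Bool) :
      LocalMove [⟨.crossing e, i⟩, ⟨.crossing (!e), i⟩] []
  /-- Third Reidemeister move for three strands with bottom ends `1, 2, 3`: here `e`, `f`, `g` tell
  whether `1` is over `2`, `1` is over `3`, `2` is over `3`. The condition says that the three
  strands lie at three different levels, one above the other. -/
  | reidemeister_three (i : ℕ) (e f g : Bool) (h : f = e ∨ f = g) :
      LocalMove [⟨.crossing e, i⟩, ⟨.crossing f, i + 1⟩, ⟨.crossing g, i⟩]
        [⟨.crossing g, i + 1⟩, ⟨.crossing f, i⟩, ⟨.crossing e, i + 1⟩]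

/-- `D'` arises from `D` by one local move inside the diagram. -/
def Move (D D' : LinkDiagram) : Prop :=
  ∃ u v l r : List Slice, LocalMove l r ∧ D.word = u ++ l ++ v ∧ D'.word = u ++ r ++ v

end LinkDiagram

/-- Unoriented links in 3-space up to isotopy: link diagrams modulo the equivalence relation
generated by the local moves. -/
def Link : Type := Quot LinkDiagram.Move

/-- `|k|` half twists of the strands `i` and `i + 1`. The strand running from the bottom left to the
top right passes under if `k > 0` and over if `k < 0`. (So a crossing of a twist with `k > 0` whose
two strands have opposite directions is a positive crossing.) -/
def twist (i : ℕ) (k : ℤ) : List Slice :=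
  List.replicate k.natAbs ⟨.crossing (decide (k < 0)), i⟩

theorem isTangle_twist {i m : ℕ} (k : ℤ) (h : i + 2 ≤ m) : IsTangle (twist i k) m m := by
  unfold twist
  induction k.natAbs with
  | zero => exact rfl
  | succ n ih =>
    refine ⟨h, ?_⟩
    have e : m - 2 + 2 = m := by omega
    simpa [Piece.ins, Piece.outs, e] using ih

/-- The diagram `K(p, q, r; a, b, c)` of girth three, given by two Y-shaped trees glued along a
circle. The six points of the knot on the circle are the strands `0, …, 5` between the first and the
second half of the word.

One side of the circle is below. It contains a Y-shaped region with three bands, which are bounded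
by the pairs of strands `01`, `23`, `45` and have `p`, `q`, `r` half twists.

The other side of the circle is above. It contains a Y-shaped region with three bands with `a`, `b`,
`c` half twists, where the first two are bounded by the pairs of strands `12` and `34` and the third
one, which ends on the outer arc from `5` to `0`, by the two middle strands of the four strands that
remain after the maximum between the first two. In the cyclic order along the circle, the six bands
are thus those of `p, a, q, b, r, c`. -/
def girthThreeDiagram (p q r a b c : ℤ) : LinkDiagram where
  word :=
    ([⟨.cup, 0⟩, ⟨.cup, 1⟩, ⟨.cup, 3⟩] ++ twist 0 p ++ twist 2 q ++ twist 4 r) ++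
    (twist 1 a ++ twist 3 b ++ [⟨.cap, 2⟩] ++ twist 1 c ++ [⟨.cap, 0⟩, ⟨.cap, 0⟩])
  closed := by
    have h₁ : IsTangle [⟨.cup, 0⟩, ⟨.cup, 1⟩, ⟨.cup, 3⟩] 0 6 := by
      simp [IsTangle, Piece.ins, Piece.outs]
    have h₂ : IsTangle [⟨.cap, 2⟩] 6 4 := by simp [IsTangle, Piece.ins, Piece.outs]
    have h₃ : IsTangle [⟨.cap, 0⟩, ⟨.cap, 0⟩] 4 0 := by simp [IsTangle, Piece.ins, Piece.outs]
    have t : ∀ i k, i + 2 ≤ 6 → IsTangle (twist i k) 6 6 := fun i k h => isTangle_twist k h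
    have t' : IsTangle (twist 1 c) 4 4 := isTangle_twist c (by norm_num)
    exact (((h₁.append (t 0 p (by norm_num))).append (t 2 q (by norm_num))).append
      (t 4 r (by norm_num))).append
      (((((t 1 a (by norm_num)).append (t 3 b (by norm_num))).append h₂).append t').append h₃)

/-- The link `K(p, q, r; a, b, c)`. -/
def girthThreeLink (p q r a b c : ℤ) : Link :=
  Quot.mk _ (girthThreeDiagram p q r a b c)

open LaurentPolynomial in
/-- The Laurent polynomial `S_n(A) = ∑_{i = 1}^n A^(2 - i) (-A³)^(n - i)` for `n ≥ 0`; the variable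
`A` is `T 1`, and `A ^ k` is `T k`. -/
noncomputable def twistPolyNat (n : ℕ) : LaurentPolynomial ℤ :=
  ∑ i ∈ Finset.Icc 1 n, T (2 - (i : ℤ)) * (-T 3) ^ (n - i)

/-- The Laurent polynomial `S_p(A)` for an integer `p`, where `S_{-p}(A) = S_p(A⁻¹)` for `p > 0`. -/
noncomputable def twistPoly (p : ℤ) : LaurentPolynomial ℤ :=
  if 0 ≤ p then twistPolyNat p.toNat else LaurentPolynomial.invert (twistPolyNat (-p).toNat)

/-!
The Kauffman bracket of a diagram is the scalar by which it acts when caps, cups and crossings are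
realised as linear operators satisfying the Temperley–Lieb relations; equal links have brackets
that agree up to a power of `-A ^ 3`. By the skein relation a band expands, up to a power of `A`,
into the uncut band plus `bandRatio` times the cut one. Hence, up to a power of `A`, the bracket of
`K(p, q, r; a, b, c)` is a part symmetric in the ratios on each side, plus `δ ^ 3 - δ`, with `δ` the
value of a circle, times the sum of the products of the ratios of opposite bands.

For even labels the ratios are divisible by `A - 1`, so a cyclic permutation of `a, b, c` does not
change the bracket modulo `(A - 1) ^ 2`. Since the bracket is `-2` modulo `A - 1`, the unknown power
of `-A ^ 3` is trivial, and the two brackets are equal. Cancelling `δ ^ 3 - δ` leaves the vanishing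
of the determinant.
-/

namespace KauffmanBracket

section Model

variable {R : Type*} [CommRing R]

/-- The functionals on which tangles act: a state labels infinitely many vertical strands by
Booleans. With infinitely many strands to the right, every slice acts at every position. -/
abbrev Functional (R : Type*) : Type _ := Stream' Bool → R

/-- An operator moved one strand to the right. -/
def indent : Module.End R (Functional R) →ₐ[R] Module.End R (Functional R) where
  toFun X :=
    { toFun ψ s := X (fun t => ψ (Stream'.cons s.head t)) s.tail
      map_add' ψ φ := by ext s; exact congrFun (X.map_add _ _) s.tail
      map_smul' c ψ := by ext s; exact congrFun (X.map_smul c _) s.tail }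
  map_one' := by ext ψ s; exact congrArg ψ s.eta
  map_mul' X Y := rfl
  map_zero' := rfl
  map_add' X Y := rfl
  commutes' c := by ext ψ s; exact congrArg (c * ψ ·) s.eta

theorem indent_apply_cons (X : Module.End R (Functional R)) (ψ : Functional R) (b : Bool)
    (s : Stream' Bool) :
    indent X ψ (Stream'.cons b s) = X (fun t => ψ (Stream'.cons b t)) s :=
  rfl

variable (A : Rˣ)

/-- The action of a local minimum on the strands `0` and `1`: a functional of the strands above it
is pulled back to the strands below it. The two legs carry different labels. -/
def leftCup : Module.End R (Functional R) where
  toFun ψ s :=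
    ψ (Stream'.cons true (Stream'.cons false s)) -
      A ^ 2 * ψ (Stream'.cons false (Stream'.cons true s))
  map_add' ψ φ := by ext s; simp only [Pi.add_apply]; ring
  map_smul' c ψ := by ext s; simp only [Pi.smul_apply, smul_eq_mul, RingHom.id_apply]; ring

/-- The weight of a local maximum whose legs carry the given labels. -/
def capWeight : Bool → Bool → R
  | false, true => 1
  | true, false => -↑A⁻¹ ^ 2
  | _, _ => 0

/-- The action of a local maximum on the strands `0` and `1`: a functional of the strands above it
is pulled back to the strands below it. -/
def leftCap : Module.End R (Functional R) where
  toFun ψ s := capWeight A s.head s.tail.head * ψ s.tail.tail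
  map_add' ψ φ := by ext s; exact mul_add _ _ _
  map_smul' c ψ := by ext s; exact mul_left_comm _ _ _

theorem leftCup_apply (ψ : Functional R) (s : Stream' Bool) :
    leftCup A ψ s = ψ (Stream'.cons true (Stream'.cons false s)) -
      A ^ 2 * ψ (Stream'.cons false (Stream'.cons true s)) :=
  rfl

theorem leftCap_apply_cons_cons (ψ : Functional R) (x y : Bool) (s : Stream' Bool) :
    leftCap A ψ (Stream'.cons x (Stream'.cons y s)) = capWeight A x y * ψ s :=
  rfl

theorem leftCup_mul_indent (Y : Module.End R (Functional R)) :
    leftCup A * indent (indent Y) = Y * leftCup A := by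
  ext ψ s
  have h : leftCup A ψ = (fun t => ψ (Stream'.cons true (Stream'.cons false t))) -
      (A : R) ^ 2 • fun t => ψ (Stream'.cons false (Stream'.cons true t)) := rfl
  rw [Module.End.mul_apply, Module.End.mul_apply, h, map_sub, map_smul]
  rfl

theorem indent_mul_leftCap (Y : Module.End R (Functional R)) :
    indent (indent Y) * leftCap A = leftCap A * Y := by
  ext ψ s
  exact congrFun (Y.map_smul (capWeight A s.head s.tail.head) ψ) s.tail.tail

/-- The value of a closed component. -/
def loop : R := -A ^ 2 - ↑A⁻¹ ^ 2

theorem leftCup_mul_leftCap : leftCup A * leftCap A = loop A • 1 := by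
  ext ψ s
  simp only [Module.End.mul_apply, leftCup_apply, leftCap_apply_cons_cons, capWeight,
    LinearMap.smul_apply, Module.End.one_apply, Pi.smul_apply, smul_eq_mul, loop]
  ring

theorem leftCup_mul_indent_leftCap : leftCup A * indent (leftCap A) = 1 := by
  ext ψ s
  obtain ⟨b, s, rfl⟩ : ∃ b t, s = Stream'.cons b t := ⟨_, _, s.eta.symm⟩
  cases b <;> simp [leftCup_apply, indent_apply_cons, leftCap_apply_cons_cons, capWeight,
    ← mul_assoc, ← mul_pow]

theorem indent_leftCup_mul_leftCap : indent (leftCup A) * leftCap A = 1 := by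
  ext ψ s
  obtain ⟨b, s, rfl⟩ : ∃ b t, s = Stream'.cons b t := ⟨_, _, s.eta.symm⟩
  cases b <;> simp [leftCup_apply, indent_apply_cons, leftCap_apply_cons_cons, capWeight,
    ← mul_assoc, ← mul_pow]

/-- The action of a local minimum with `i` vertical strands to its left. -/
def cup (i : ℕ) : Module.End R (Functional R) := (indent ^ i) (leftCup A)

/-- The action of a local maximum with `i` vertical strands to its left. -/
def cap (i : ℕ) : Module.End R (Functional R) := (indent ^ i) (leftCap A)

theorem cup_mul_indent_pow (i : ℕ) (Y : Module.End R (Functional R)) :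
    cup A i * (indent ^ (i + 2)) Y = (indent ^ i) Y * cup A i := by
  rw [cup, pow_add, AlgHom.mul_apply, ← map_mul, ← map_mul]
  exact congrArg _ (leftCup_mul_indent A Y)

theorem indent_pow_mul_cap (i : ℕ) (Y : Module.End R (Functional R)) :
    (indent ^ (i + 2)) Y * cap A i = cap A i * (indent ^ i) Y := by
  rw [cap, pow_add, AlgHom.mul_apply, ← map_mul, ← map_mul]
  exact congrArg _ (indent_mul_leftCap A Y)

theorem cup_mul_cap_self (i : ℕ) : cup A i * cap A i = loop A • 1 := by
  rw [cup, cap, ← map_mul, leftCup_mul_leftCap, map_smul, map_one]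

theorem cup_mul_cap_succ (i : ℕ) : cup A i * cap A (i + 1) = 1 := by
  rw [cup, cap, pow_succ, AlgHom.mul_apply, ← map_mul, leftCup_mul_indent_leftCap, map_one]

theorem cup_succ_mul_cap (i : ℕ) : cup A (i + 1) * cap A i = 1 := by
  rw [cup, cap, pow_succ, AlgHom.mul_apply, ← map_mul, indent_leftCup_mul_leftCap, map_one]

/-- The weight of the smoothing of `crossing e` into two vertical strands. The other smoothing has
the inverse weight. -/
def crossingWeight (e : Bool) : Rˣ := bif e then A else A⁻¹

theorem crossingWeight_not (e : Bool) : crossingWeight A (!e) = (crossingWeight A e)⁻¹ := by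
  cases e <;> simp [crossingWeight]

theorem loop_eq (e : Bool) :
    loop A = -↑(crossingWeight A e) ^ 2 - ↑(crossingWeight A e)⁻¹ ^ 2 := by
  cases e
  · simp only [crossingWeight, cond_false, inv_inv, loop]
    ring
  · rfl

/-- The action of a crossing with `i` vertical strands to its left, by Kauffman's skein relation. -/
def crossing (e : Bool) (i : ℕ) : Module.End R (Functional R) :=
  (crossingWeight A e : R) • 1 + (↑(crossingWeight A e)⁻¹ : R) • (cap A i * cup A i)

/-- The action of a slice. -/
def slice : Slice → Module.End R (Functional R)
  | ⟨.cup, i⟩ => cup A i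
  | ⟨.cap, i⟩ => cap A i
  | ⟨.crossing e, i⟩ => crossing A e i

theorem slice_eq_indent_pow (x : Piece) (i : ℕ) :
    slice A ⟨x, i⟩ = (indent ^ i) (slice A ⟨x, 0⟩) := by
  cases x <;> simp only [slice, crossing, cup, cap, pow_zero, AlgHom.one_apply, map_add, map_smul,
    map_one, map_mul]

theorem slice_mul_indent_pow (x : Piece) (i k : ℕ) (Y : Module.End R (Functional R)) :
    slice A ⟨x, i⟩ * (indent ^ (i + x.outs + k)) Y =
      (indent ^ (i + x.ins + k)) Y * slice A ⟨x, i⟩ := by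
  have cup_mul : cup A i * (indent ^ (i + 2 + k)) Y = (indent ^ (i + k)) Y * cup A i := by
    rw [pow_add _ (i + 2), pow_add _ i k, AlgHom.mul_apply, AlgHom.mul_apply, cup_mul_indent_pow]
  have mul_cap : (indent ^ (i + 2 + k)) Y * cap A i = cap A i * (indent ^ (i + k)) Y := by
    rw [pow_add _ (i + 2), pow_add _ i k, AlgHom.mul_apply, AlgHom.mul_apply, indent_pow_mul_cap]
  cases x with
  | cup => exact cup_mul
  | cap => exact mul_cap.symm
  | crossing e =>
    simp only [slice, crossing, Piece.ins, Piece.outs, add_mul, mul_add, smul_mul_assoc,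
      mul_smul_comm, one_mul, mul_one, mul_assoc, cup_mul]
    simp only [← mul_assoc, mul_cap]

theorem slice_mul_slice (x y : Piece) (i k : ℕ) :
    slice A ⟨x, i⟩ * slice A ⟨y, i + x.outs + k⟩ =
      slice A ⟨y, i + x.ins + k⟩ * slice A ⟨x, i⟩ := by
  rw [slice_eq_indent_pow A y (i + x.outs + k), slice_eq_indent_pow A y (i + x.ins + k),
    slice_mul_indent_pow]

theorem crossing_mul_cap_succ (e : Bool) (i : ℕ) :
    crossing A e i * cap A (i + 1) = crossing A (!e) (i + 1) * cap A i := by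
  simp only [crossing, crossingWeight_not, inv_inv, add_mul, smul_mul_assoc, one_mul, mul_assoc,
    cup_mul_cap_succ, cup_succ_mul_cap, mul_one, add_comm]

theorem cup_succ_mul_crossing (e : Bool) (i : ℕ) :
    cup A (i + 1) * crossing A e i = cup A i * crossing A (!e) (i + 1) := by
  simp only [crossing, crossingWeight_not, inv_inv, mul_add, mul_smul_comm, mul_one, ← mul_assoc,
    cup_mul_cap_succ, cup_succ_mul_cap, one_mul, add_comm]

/-- The factor by which a curl changes the bracket. -/
def curl : Rˣ := -A ^ 3

theorem curl_crossingWeight_mem_zpowers (e : Bool) :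
    curl (crossingWeight A e) ∈ Subgroup.zpowers (curl A) := by
  cases e
  · refine Subgroup.mem_zpowers_iff.2 ⟨-1, ?_⟩
    simp [curl, crossingWeight]
  · exact Subgroup.mem_zpowers _

theorem crossingWeight_add_inv_mul_loop (e : Bool) :
    ↑(crossingWeight A e) + ↑(crossingWeight A e)⁻¹ * loop A =
      (↑(curl (crossingWeight A e))⁻¹ : R) := by
  have h := (crossingWeight A e).mul_inv
  simp only [loop_eq A e, curl, inv_neg, ← inv_pow, Units.val_neg, Units.val_pow_eq_pow_val]
  linear_combination (-(crossingWeight A e : R)) * h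

theorem crossing_mul_cap (e : Bool) (i : ℕ) :
    crossing A e i * cap A i = (↑(curl (crossingWeight A e))⁻¹ : R) • cap A i := by
  rw [← crossingWeight_add_inv_mul_loop, crossing, add_mul, smul_mul_assoc, smul_mul_assoc,
    mul_assoc, cup_mul_cap_self, one_mul, mul_smul_comm, mul_one, smul_smul, add_smul]

theorem cup_mul_crossing (e : Bool) (i : ℕ) :
    cup A i * crossing A e i = (↑(curl (crossingWeight A e))⁻¹ : R) • cup A i := by
  rw [← crossingWeight_add_inv_mul_loop, crossing, mul_add, mul_smul_comm, mul_smul_comm,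
    ← mul_assoc, cup_mul_cap_self, mul_one, smul_mul_assoc, one_mul, smul_smul, add_smul]

theorem crossing_mul_crossing_not (e : Bool) (i : ℕ) :
    crossing A e i * crossing A (!e) i = 1 := by
  have h := (crossingWeight A e).mul_inv
  have h_curl : (crossingWeight A e : R) * ↑(curl (crossingWeight A e))⁻¹ =
      -(↑(crossingWeight A e)⁻¹ * ↑(crossingWeight A e)⁻¹) := by
    simp only [curl, inv_neg, ← inv_pow, Units.val_neg, Units.val_pow_eq_pow_val]
    linear_combination (-(↑(crossingWeight A e)⁻¹ : R) ^ 2) * h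
  calc crossing A e i * crossing A (!e) i
      = (↑(crossingWeight A e)⁻¹ : R) • crossing A e i +
          (crossingWeight A e : R) • (crossing A e i * cap A i * cup A i) := by
        rw [crossing.eq_def A (!e), crossingWeight_not, inv_inv, mul_add, mul_smul_comm,
          mul_smul_comm, mul_one, mul_assoc]
    _ = 1 := by
        rw [crossing_mul_cap, smul_mul_assoc, smul_smul, h_curl, crossing, smul_add, smul_smul,
          smul_smul, Units.inv_mul, one_smul, neg_smul, add_neg_cancel_right]

theorem crossing_not_mul_crossing (e : Bool) (i : ℕ) :
    crossing A (!e) i * crossing A e i = 1 := by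
  simpa only [Bool.not_not] using crossing_mul_crossing_not A (!e) i

theorem crossing_mul_crossing_succ_mul_cap (e : Bool) (i : ℕ) :
    crossing A e i * crossing A e (i + 1) * cap A i = cap A (i + 1) := by
  have slide := crossing_mul_cap_succ A (!e) i
  rw [Bool.not_not] at slide
  rw [mul_assoc, ← slide, ← mul_assoc, crossing_mul_crossing_not, one_mul]

theorem crossing_succ_mul_crossing_mul_cap_succ (e : Bool) (i : ℕ) :
    crossing A e (i + 1) * crossing A e i * cap A (i + 1) = cap A i := by
  rw [mul_assoc, crossing_mul_cap_succ, ← mul_assoc, crossing_mul_crossing_not, one_mul]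

theorem cup_succ_mul_crossing_mul_crossing_succ (e : Bool) (i : ℕ) :
    cup A (i + 1) * (crossing A e i * crossing A e (i + 1)) = cup A i := by
  rw [← mul_assoc, cup_succ_mul_crossing, mul_assoc, crossing_not_mul_crossing, mul_one]

theorem cup_mul_crossing_succ_mul_crossing (e : Bool) (i : ℕ) :
    cup A i * (crossing A e (i + 1) * crossing A e i) = cup A (i + 1) := by
  have slide := cup_succ_mul_crossing A (!e) i
  rw [Bool.not_not] at slide
  rw [← mul_assoc, ← slide, mul_assoc, crossing_not_mul_crossing, mul_one]

-- The crossing that differs from the other two is smoothed; a maximum or minimum of the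
-- smoothing then slides past the two crossings of equal kind.
theorem crossing_braid (e f g : Bool) (i : ℕ) (h : f = e ∨ f = g) :
    crossing A e i * crossing A f (i + 1) * crossing A g i =
      crossing A g (i + 1) * crossing A f i * crossing A e (i + 1) := by
  rcases h with rfl | rfl
  · have hcap := crossing_mul_crossing_succ_mul_cap A f i
    have hcup := cup_succ_mul_crossing_mul_crossing_succ A f i
    rw [crossing.eq_def A g i, crossing.eq_def A g (i + 1), mul_assoc (_ + _)]
    simp only [mul_add, add_mul, mul_smul_comm, smul_mul_assoc, mul_one, one_mul]
    rw [← mul_assoc, hcap, mul_assoc (cap A (i + 1)), hcup]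
  · have hcap := crossing_succ_mul_crossing_mul_cap_succ A f i
    have hcup := cup_mul_crossing_succ_mul_crossing A f i
    rw [crossing.eq_def A e i, crossing.eq_def A e (i + 1), mul_assoc (_ + _)]
    simp only [mul_add, add_mul, mul_smul_comm, smul_mul_assoc, mul_one, one_mul]
    rw [← mul_assoc (_ * _) (cap A (i + 1)), hcap, mul_assoc (cap A i), hcup]

/-- The action of a tangle. -/
def tangle (w : List Slice) : Module.End R (Functional R) := (w.map (slice A)).prod

theorem tangle_append (v w : List Slice) : tangle A (v ++ w) = tangle A v * tangle A w := by
  rw [tangle, List.map_append, List.prod_append, tangle, tangle]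

theorem tangle_cons (s : Slice) (w : List Slice) : tangle A (s :: w) = slice A s * tangle A w := by
  rw [tangle, List.map_cons, List.prod_cons, tangle]

theorem tangle_nil : tangle A [] = 1 := rfl

theorem exists_tangle_eq_smul {l r : List Slice} (h : LinkDiagram.LocalMove l r) :
    ∃ c ∈ Subgroup.zpowers (curl A), tangle A l = (c : R) • tangle A r := by
  have invariant (h : tangle A l = tangle A r) :
      ∃ c ∈ Subgroup.zpowers (curl A), tangle A l = (c : R) • tangle A r :=
    ⟨1, one_mem _, by rw [h, Units.val_one, one_smul]⟩
  have curl_inv_mem (e : Bool) := inv_mem (curl_crossingWeight_mem_zpowers A e)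
  cases h with
  | exchange x y i k => exact invariant (slice_mul_slice A x y i k)
  | zigzag_right i => exact invariant (cup_mul_cap_succ A i)
  | zigzag_left i => exact invariant (cup_succ_mul_cap A i)
  | slide_cap i e => exact invariant (crossing_mul_cap_succ A e i)
  | slide_cup i e => exact invariant (cup_succ_mul_crossing A e i)
  | reidemeister_one_cap i e => exact ⟨_, curl_inv_mem e, crossing_mul_cap A e i⟩
  | reidemeister_one_cup i e => exact ⟨_, curl_inv_mem e, cup_mul_crossing A e i⟩
  | reidemeister_two i e => exact invariant (crossing_mul_crossing_not A e i)
  | reidemeister_three i e f g h => exact invariant (crossing_braid A e f g i h)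

/-- The Kauffman bracket of a diagram. The diagram acts on functionals as a scalar, which is read
off from its action on the functional `1`. -/
def bracket (D : LinkDiagram) : R := tangle A D.word 1 (Stream'.const false)

theorem exists_bracket_eq_mul {D D' : LinkDiagram} (h : LinkDiagram.Move D D') :
    ∃ c ∈ Subgroup.zpowers (curl A), bracket A D = c * bracket A D' := by
  obtain ⟨u, v, l, r, hlr, hD, hD'⟩ := h
  obtain ⟨c, hc, h⟩ := exists_tangle_eq_smul A hlr
  refine ⟨c, hc, ?_⟩
  rw [bracket, bracket, hD, hD', tangle_append, tangle_append, tangle_append, tangle_append, h,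
    mul_smul_comm, smul_mul_assoc]
  rfl

/-- The Kauffman bracket of a link, which is defined up to powers of `curl A`. -/
def linkBracket : Link → MulAction.orbitRel.Quotient (Subgroup.zpowers (curl A)) R :=
  Quot.lift (fun D => Quotient.mk _ (bracket A D)) fun _ _ h => by
    obtain ⟨c, hc, h⟩ := exists_bracket_eq_mul A h
    exact Quotient.sound ⟨⟨c, hc⟩, h.symm⟩

theorem exists_bracket_eq_curl_zpow_mul {D D' : LinkDiagram}
    (h : (Quot.mk _ D : Link) = Quot.mk _ D') :
    ∃ k : ℤ, bracket A D = ↑(curl A ^ k) * bracket A D' := by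
  obtain ⟨⟨_, k, rfl⟩, h⟩ := Quotient.exact (congrArg (linkBracket A) h)
  exact ⟨k, h.symm⟩

section TemperleyLieb

variable (ψ : Functional R)

theorem cup_cap_self (i : ℕ) : cup A i (cap A i ψ) = loop A • ψ :=
  LinearMap.congr_fun (cup_mul_cap_self A i) ψ

theorem cup_cap_succ (i : ℕ) : cup A i (cap A (i + 1) ψ) = ψ :=
  LinearMap.congr_fun (cup_mul_cap_succ A i) ψ

theorem cup_succ_cap (i : ℕ) : cup A (i + 1) (cap A i ψ) = ψ :=
  LinearMap.congr_fun (cup_succ_mul_cap A i) ψ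

theorem cup_cap_of_add_two_le {i j : ℕ} (h : i + 2 ≤ j) :
    cup A i (cap A j ψ) = cap A (j - 2) (cup A i ψ) := by
  obtain ⟨k, rfl⟩ := Nat.exists_eq_add_of_le h
  rw [show i + 2 + k - 2 = i + k by omega]
  exact LinearMap.congr_fun (slice_mul_slice A .cup .cap i k) ψ

theorem cup_cap_of_le_sub_two {i j : ℕ} (h : j + 2 ≤ i) :
    cup A i (cap A j ψ) = cap A j (cup A (i - 2) ψ) := by
  obtain ⟨k, rfl⟩ := Nat.exists_eq_add_of_le h
  rw [show j + 2 + k - 2 = j + k by omega]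
  exact LinearMap.congr_fun (slice_mul_slice A .cap .cup j k).symm ψ

theorem cup_cup_of_add_two_le {i j : ℕ} (h : i + 2 ≤ j) :
    cup A i (cup A j ψ) = cup A (j - 2) (cup A i ψ) := by
  obtain ⟨k, rfl⟩ := Nat.exists_eq_add_of_le h
  rw [show i + 2 + k - 2 = i + k by omega]
  exact LinearMap.congr_fun (slice_mul_slice A .cup .cup i k) ψ

theorem cap_cap_of_add_two_le {i j : ℕ} (h : j + 2 ≤ i) :
    cap A i (cap A j ψ) = cap A j (cap A (i - 2) ψ) := by
  obtain ⟨k, rfl⟩ := Nat.exists_eq_add_of_le h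
  rw [show j + 2 + k - 2 = j + k by omega]
  exact LinearMap.congr_fun (slice_mul_slice A .cap .cap j k).symm ψ

end TemperleyLieb

theorem one_add_smul_pow {S : Type*} [Ring S] [Algebra R S] {U : S} {d : R} (h : U * U = d • U)
    (c : R) (n : ℕ) :
    (1 + c • U) ^ n = 1 + (c * ∑ i ∈ Finset.range n, (1 + c * d) ^ i) • U := by
  induction n with
  | zero => simp
  | succ n ih =>
    have h_geom : c * d * ∑ i ∈ Finset.range n, (1 + c * d) ^ i = (1 + c * d) ^ n - 1 := by
      simpa only [add_sub_cancel_left] using mul_geom_sum (1 + c * d) n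
    rw [pow_succ, ih, geom_sum_succ']
    simp only [mul_add, add_mul, one_mul, mul_one, smul_mul_smul_comm, h]
    match_scalars
    · rfl
    · linear_combination c * h_geom

/-- The coefficient of the cut band, relative to the uncut one, in the expansion of a band with `k`
half twists. -/
def bandRatio (k : ℤ) : R :=
  ↑(crossingWeight A (decide (k < 0)))⁻¹ ^ 2 *
    ∑ i ∈ Finset.range k.natAbs, (-(↑(crossingWeight A (decide (k < 0)))⁻¹ : R) ^ 4) ^ i

theorem crossingWeight_pow_natAbs (k : ℤ) :
    crossingWeight A (decide (k < 0)) ^ k.natAbs = A ^ (-k) := by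
  rcases lt_or_ge k 0 with hk | hk
  · rw [decide_eq_true hk, ← Int.ofNat_natAbs_of_nonpos hk.le, zpow_natCast]
    rfl
  · rw [decide_eq_false hk.not_gt, zpow_neg, ← inv_zpow, ← Int.natAbs_of_nonneg hk,
      Int.natAbs_natCast, zpow_natCast]
    rfl

theorem tangle_twist (i : ℕ) (k : ℤ) :
    tangle A (twist i k) = (↑(A ^ (-k)) : R) • (1 + bandRatio A k • (cap A i * cup A i)) := by
  have h_sq : cap A i * cup A i * (cap A i * cup A i) = loop A • (cap A i * cup A i) := by
    rw [mul_assoc, ← mul_assoc (cup A i), cup_mul_cap_self, smul_mul_assoc, one_mul, mul_smul_comm]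
  rw [tangle, twist, List.map_replicate, List.prod_replicate, slice, ← crossingWeight_pow_natAbs,
    bandRatio]
  set w := crossingWeight A (decide (k < 0)) with hw
  have h_inv : (↑w⁻¹ : R) * w = 1 := w.inv_mul
  have h_crossing : crossing A (decide (k < 0)) i =
      (w : R) • (1 + (↑w⁻¹ : R) ^ 2 • (cap A i * cup A i)) := by
    rw [crossing, ← hw, smul_add, smul_smul]
    congr 2
    linear_combination (-(↑w⁻¹ : R)) * h_inv
  have h_ratio : 1 + (↑w⁻¹ : R) ^ 2 * loop A = -(↑w⁻¹ : R) ^ 4 := by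
    rw [loop_eq A (decide (k < 0)), ← hw]
    linear_combination (-(↑w⁻¹ : R) * w - 1) * h_inv
  rw [h_crossing, smul_pow, one_add_smul_pow h_sq, h_ratio, Units.val_pow_eq_pow_val]

/-- The coefficient of the fully cut surface in the expansion of a Y-shaped band surface: at least
two of its three bands are cut, and cutting the third one splits off a closed component. -/
def cutCoeff (x y z : R) : R := x * y + y * z + z * x + loop A * (x * y * z)

theorem tangle_lower_apply (p q r : ℤ) (ψ : Functional R) :
    tangle A ([⟨.cup, 0⟩, ⟨.cup, 1⟩, ⟨.cup, 3⟩] ++ twist 0 p ++ twist 2 q ++ twist 4 r) ψ =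
      (↑(A ^ (-(p + q + r))) : R) •
        (cup A 0 (cup A 1 (cup A 1 ψ)) + bandRatio A p • cup A 0 (cup A 1 (cup A 0 ψ)) +
          bandRatio A q • cup A 0 (cup A 1 (cup A 2 ψ)) +
          bandRatio A r • cup A 0 (cup A 0 (cup A 1 ψ)) +
          cutCoeff A (bandRatio A p) (bandRatio A q) (bandRatio A r) •
            cup A 0 (cup A 0 (cup A 0 ψ))) := by
  simp only [neg_add, zpow_add, Units.val_mul, cutCoeff, tangle_append, tangle_cons, tangle_nil,
    slice, tangle_twist, Module.End.mul_apply, Module.End.one_apply, LinearMap.add_apply,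
    LinearMap.smul_apply, map_add, map_smul, cup_cap_self, cup_cap_succ, cup_succ_cap,
    cup_cap_of_add_two_le, cup_cap_of_le_sub_two, cup_cup_of_add_two_le, Nat.reduceLeDiff,
    Nat.reduceAdd, Nat.reduceSub]
  module

theorem tangle_upper_apply (a b c : ℤ) (ψ : Functional R) :
    tangle A (twist 1 a ++ twist 3 b ++ [⟨.cap, 2⟩] ++ twist 1 c ++ [⟨.cap, 0⟩, ⟨.cap, 0⟩]) ψ =
      (↑(A ^ (-(a + b + c))) : R) •
        (cap A 0 (cap A 0 (cap A 0 ψ)) + bandRatio A a • cap A 1 (cap A 0 (cap A 0 ψ)) +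
          bandRatio A b • cap A 0 (cap A 1 (cap A 0 ψ)) +
          bandRatio A c • cap A 2 (cap A 1 (cap A 0 ψ)) +
          cutCoeff A (bandRatio A a) (bandRatio A b) (bandRatio A c) •
            cap A 1 (cap A 1 (cap A 0 ψ))) := by
  simp only [neg_add, zpow_add, Units.val_mul, cutCoeff, tangle_append, tangle_cons, tangle_nil,
    slice, tangle_twist, Module.End.mul_apply, Module.End.one_apply, LinearMap.add_apply,
    LinearMap.smul_apply, map_add, map_smul, cup_cap_self, cup_cap_succ, cup_succ_cap,
    cup_cap_of_le_sub_two, cap_cap_of_add_two_le, Nat.reduceLeDiff, Nat.reduceAdd, Nat.reduceSub]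
  module

/-- The terms of the bracket of `girthThreeDiagram`, normalised by a power of `A`, that are
symmetric in the band ratios on each side. -/
def symmetricPart (x y z u v w : R) : R :=
  loop A + loop A ^ 2 * (x + y + z + (u + v + w)) + loop A * ((x + y + z) * (u + v + w)) +
    loop A ^ 3 * (cutCoeff A x y z + cutCoeff A u v w) +
    loop A ^ 2 * ((x + y + z) * cutCoeff A u v w + (u + v + w) * cutCoeff A x y z) +
    loop A * (cutCoeff A x y z * cutCoeff A u v w)

theorem bracket_girthThreeDiagram (p q r a b c : ℤ) :
    bracket A (girthThreeDiagram p q r a b c) =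
      ↑(A ^ (-(p + q + r + (a + b + c)))) *
        (symmetricPart A (bandRatio A p) (bandRatio A q) (bandRatio A r)
            (bandRatio A a) (bandRatio A b) (bandRatio A c) +
          (loop A ^ 3 - loop A) * (bandRatio A p * bandRatio A b + bandRatio A q * bandRatio A c +
            bandRatio A r * bandRatio A a)) := by
  rw [bracket, girthThreeDiagram, tangle_append, Module.End.mul_apply, tangle_lower_apply,
    tangle_upper_apply, neg_add (p + q + r), zpow_add, Units.val_mul]
  simp only [symmetricPart, map_add, map_smul, cup_cap_self, cup_cap_succ, cup_succ_cap,
    cup_cap_of_add_two_le, cup_cap_of_le_sub_two, Nat.reduceLeDiff, Nat.reduceAdd, Nat.reduceSub,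
    Pi.add_apply, Pi.smul_apply, Pi.one_apply, smul_eq_mul, mul_one]
  ring

theorem bracket_girthThreeDiagram_sub (p q r a b c : ℤ) :
    bracket A (girthThreeDiagram p q r a b c) - bracket A (girthThreeDiagram p q r c a b) =
      ↑(A ^ (-(p + q + r + (a + b + c)))) * ((loop A ^ 3 - loop A) *
        (bandRatio A p * (bandRatio A b - bandRatio A a) +
          bandRatio A q * (bandRatio A c - bandRatio A b) +
          bandRatio A r * (bandRatio A a - bandRatio A c))) := by
  rw [bracket_girthThreeDiagram, bracket_girthThreeDiagram, show c + a + b = a + b + c by ring]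
  simp only [symmetricPart, cutCoeff]
  ring

end Model

open LaurentPolynomial

open scoped DualNumber

/-- The variable of the Laurent polynomials. -/
noncomputable def var : ℤ[T;T⁻¹]ˣ := unitOfInvertible (T 1)

theorem val_var : (var : ℤ[T;T⁻¹]) = T 1 := rfl

theorem val_inv_var : (↑var⁻¹ : ℤ[T;T⁻¹]) = T (-1) := rfl

theorem twistPolyNat_mul_T (n : ℕ) :
    twistPolyNat n * T n = T 2 * ∑ i ∈ Finset.range n, (-T 4) ^ i := by
  rw [twistPolyNat, Finset.sum_mul, Finset.mul_sum]
  refine Finset.sum_bij' (fun i _ => n - i) (fun j _ => n - j) ?_ ?_ ?_ ?_ ?_ <;>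
    simp only [Finset.mem_Icc, Finset.mem_range] <;> try omega
  rintro i ⟨-, hi⟩
  obtain ⟨m, rfl⟩ := Nat.exists_eq_add_of_le hi
  have h : (T (2 - (i : ℤ)) * T (m * 3) * T (i + m) : ℤ[T;T⁻¹]) = T 2 * T (m * 4) := by
    rw [← T_add, ← T_add, ← T_add]
    congr 1
    ring
  rw [Nat.add_sub_cancel_left, neg_pow, neg_pow (T 4 : ℤ[T;T⁻¹]), T_pow, T_pow, Nat.cast_add]
  linear_combination (-1) ^ m * h

theorem bandRatio_var (k : ℤ) : bandRatio var k = twistPoly k * T k := by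
  obtain hk | hk := lt_or_ge k 0
  · obtain ⟨n, rfl⟩ := Int.exists_eq_neg_ofNat hk.le
    rw [bandRatio, twistPoly, if_neg hk.not_ge, decide_eq_true hk]
    simp only [crossingWeight, cond_true, val_inv_var, T_pow]
    have h := congrArg invert (twistPolyNat_mul_T n)
    simpa using h.symm
  · obtain ⟨n, rfl⟩ := Int.eq_ofNat_of_zero_le hk
    rw [bandRatio, twistPoly, if_pos hk, decide_eq_false hk.not_gt]
    simp only [crossingWeight, cond_false, inv_inv, val_var, T_pow]
    simpa using (twistPolyNat_mul_T n).symm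

/-- Evaluation of Laurent polynomials at `1 + ε`. -/
noncomputable def evalOneAddEps : ℤ[T;T⁻¹] →ₐ[ℤ] ℤ[ε] :=
  AddMonoidAlgebra.lift ℤ _ ℤ
    { toFun n := 1 + n.toAdd • ε
      map_one' := by simp
      map_mul' m n := by ext <;> simp [add_comm] }

theorem evalOneAddEps_T (n : ℤ) : evalOneAddEps (T n) = 1 + n • ε :=
  (AddMonoidAlgebra.lift_single _ _ _).trans (one_smul _ _)

theorem fst_evalOneAddEps_T (n : ℤ) : (evalOneAddEps (T n)).fst = 1 := by
  simp [evalOneAddEps_T]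

theorem fst_evalOneAddEps_bandRatio {k : ℤ} (hk : Even k) :
    (evalOneAddEps (bandRatio var k)).fst = 0 := by
  have h (e : Bool) : (evalOneAddEps ↑(crossingWeight var e)⁻¹).fst = 1 := by
    cases e <;> simp [crossingWeight, val_var, val_inv_var, fst_evalOneAddEps_T]
  simp [bandRatio, h, TrivSqZeroExt.fst_sum, neg_one_geom_sum, hk]

theorem fst_evalOneAddEps_loop : (evalOneAddEps (loop var)).fst = -2 := by
  simp [loop, val_var, val_inv_var, fst_evalOneAddEps_T]

theorem val_var_zpow (k : ℤ) : (↑(var ^ k) : ℤ[T;T⁻¹]) = T k := by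
  obtain ⟨n, rfl | rfl⟩ := k.eq_nat_or_neg
  · simp [val_var, T_pow]
  · simp [val_inv_var, T_pow, ← inv_pow]

theorem fst_evalOneAddEps_bracket {p q r a b c : ℤ} (hp : Even p) (hq : Even q) (hr : Even r)
    (ha : Even a) (hb : Even b) (hc : Even c) :
    (evalOneAddEps (bracket var (girthThreeDiagram p q r a b c))).fst = -2 := by
  simp [bracket_girthThreeDiagram, symmetricPart, cutCoeff, val_var_zpow, fst_evalOneAddEps_T,
    fst_evalOneAddEps_loop, fst_evalOneAddEps_bandRatio, hp, hq, hr, ha, hb, hc]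

theorem evalOneAddEps_bracket_eq {p q r a b c : ℤ} (hp : Even p) (hq : Even q) (hr : Even r)
    (ha : Even a) (hb : Even b) (hc : Even c) :
    evalOneAddEps (bracket var (girthThreeDiagram p q r a b c)) =
      evalOneAddEps (bracket var (girthThreeDiagram p q r c a b)) := by
  rw [← sub_eq_zero, ← map_sub, bracket_girthThreeDiagram_sub]
  have h_mul {k l m : ℤ} (hk : Even k) (hl : Even l) (hm : Even m) :
      evalOneAddEps (bandRatio var k * (bandRatio var l - bandRatio var m)) = 0 := by
    ext <;> simp [fst_evalOneAddEps_bandRatio, hk, hl, hm]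
  rw [map_mul, map_mul, map_add, map_add, h_mul hp hb ha, h_mul hq hc hb, h_mul hr ha hc]
  simp only [add_zero, mul_zero]

theorem eq_zero_of_evalOneAddEps_curl_zpow_mul {k : ℤ} {x : ℤ[ε]} (hx : x.fst ≠ 0)
    (h : evalOneAddEps ↑(curl var ^ k) * x = x) : k = 0 := by
  have h_sq : (↑(curl var ^ k) * ↑(curl var ^ k) : ℤ[T;T⁻¹]) = T (6 * k) := by
    rw [← Units.val_mul, ← mul_zpow, ← val_var_zpow, zpow_mul, curl, neg_mul_neg, ← pow_add]
    rfl
  have h_mul : (1 + (6 * k) • ε) * x = x := by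
    rw [← evalOneAddEps_T, ← h_sq, map_mul, mul_assoc, h, h]
  have h_snd := congrArg TrivSqZeroExt.snd h_mul
  simpa [hx, show (6 : ℤ[ε]).fst = 6 from rfl] using h_snd

theorem bracket_eq_of_girthThreeLink_eq {p q r a b c : ℤ} (hp : Even p) (hq : Even q)
    (hr : Even r) (ha : Even a) (hb : Even b) (hc : Even c)
    (h : girthThreeLink p q r a b c = girthThreeLink p q r c a b) :
    bracket var (girthThreeDiagram p q r a b c) = bracket var (girthThreeDiagram p q r c a b) := by
  obtain ⟨k, hk⟩ := exists_bracket_eq_curl_zpow_mul var h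
  have h_eval := congrArg evalOneAddEps hk
  rw [map_mul, evalOneAddEps_bracket_eq hp hq hr ha hb hc] at h_eval
  have h_fst := fst_evalOneAddEps_bracket hp hq hr hc ha hb
  obtain rfl : k = 0 := eq_zero_of_evalOneAddEps_curl_zpow_mul (by rw [h_fst]; decide) h_eval.symm
  simpa only [zpow_zero, Units.val_one, one_mul] using hk

theorem loop_var_pow_three_sub_ne_zero : loop var ^ 3 - loop var ≠ 0 := by
  intro h
  have h_fst := congrArg (TrivSqZeroExt.fst ∘ evalOneAddEps) h
  simp [fst_evalOneAddEps_loop] at h_fst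

theorem sum_bandRatio_mul_sub_eq_zero {p q r a b c : ℤ} (hp : Even p) (hq : Even q)
    (hr : Even r) (ha : Even a) (hb : Even b) (hc : Even c)
    (h : girthThreeLink p q r a b c = girthThreeLink p q r c a b) :
    bandRatio var p * (bandRatio var b - bandRatio var a) +
      bandRatio var q * (bandRatio var c - bandRatio var b) +
      bandRatio var r * (bandRatio var a - bandRatio var c) = 0 := by
  have h_sub := bracket_girthThreeDiagram_sub var p q r a b c
  rw [bracket_eq_of_girthThreeLink_eq hp hq hr ha hb hc h, sub_self, eq_comm,
    Units.mul_right_eq_zero] at h_sub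
  exact (mul_eq_zero.1 h_sub).resolve_left loop_var_pow_three_sub_ne_zero

end KauffmanBracket

open KauffmanBracket in
theorem theorem4p8 (p q r a b c : ℤ) (hp : Even p) (hq : Even q) (hr : Even r)
    (ha : Even a) (hb : Even b) (hc : Even c) :
    (girthThreeLink p q r a b c = girthThreeLink p q r c a b →
      Matrix.det
        !![twistPoly p * LaurentPolynomial.T p, twistPoly q * LaurentPolynomial.T q,
            twistPoly r * LaurentPolynomial.T r;
          twistPoly c * LaurentPolynomial.T c, twistPoly a * LaurentPolynomial.T a,
            twistPoly b * LaurentPolynomial.T b;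
          1, 1, 1] = 0) ∧
    (girthThreeLink p q r a b c = girthThreeLink p q r b c a →
      Matrix.det
        !![twistPoly p * LaurentPolynomial.T p, twistPoly q * LaurentPolynomial.T q,
            twistPoly r * LaurentPolynomial.T r;
          twistPoly a * LaurentPolynomial.T a, twistPoly b * LaurentPolynomial.T b,
            twistPoly c * LaurentPolynomial.T c;
          1, 1, 1] = 0) := by
  simp only [← bandRatio_var, Matrix.det_fin_three, Matrix.of_apply, Matrix.cons_val',
    Matrix.cons_val_zero, Matrix.cons_val_fin_one, Matrix.cons_val_one, Matrix.cons_val, mul_one]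
  constructor <;> intro h
  · have h_sum := sum_bandRatio_mul_sub_eq_zero hp hq hr ha hb hc h
    linear_combination -h_sum
  · have h_sum := sum_bandRatio_mul_sub_eq_zero hp hq hr hb hc ha h.symm
    linear_combination -h_sum
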